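/- Let $\mathcal H$ be a real Hilbert space and let $f:\mathcal H\to\,]-\infty,+\infty]$ be proper, lower semicontinuous and convex, with conjugate $f^*(u)=\sup_x(\langle x,u\rangle-f(x))$ and subdifferential $\partial f$. Gradients $\nabla f$, $\nabla f^*$ are Gâteaux gradients, taken on $\operatorname{int}\operatorname{dom} f$ and $\operatorname{int}\operatorname{dom} f^*$ respectively. Assume that $f$ is Legendre, that is: (a) $f$ is essentially smooth: $\operatorname{dom}\partial f=\operatorname{int}\operatorname{dom} f\neq\varnothing$, $f$ is Gâteaux differentiable on $\operatorname{int}\operatorname{dom} f$, and $\|\nabla f(x_k)\|\to+\infty$ for every sequence $(x_k)$ in $\operatorname{int}\operatorname{dom} f$ converging to a boundary point of $\operatorname{dom} f$; (b) $f$ is essentially strictly convex: $(\partial f)^{-1}$ is locally bounded on its domain, and $f$ is strictly convex on every convex subset of $\operatorname{dom}\partial f$. Let $D_f(x,y)=f(x)-f(y)-\langle\nabla f(y),x-y\rangle$ if $y\in\operatorname{int}\operatorname{dom} f$ and $D_f(x,y)=+\infty$ otherwise. Let $\mathcal S=\{p_0,p_1,\dots,p_m\}\subseteq\operatorname{dom}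 f$, let $\operatorname{aff}(\mathcal S)$ be its affine hull, $M=\operatorname{span}\{p_1-p_0,\dots,p_m-p_0\}$, and $$\overrightarrow E_f(\mathcal S)=\{q\in\operatorname{int}\operatorname{dom} f: D_f(p_0,q)=D_f(p_1,q)=\dots=D_f(p_m,q)\}.$$ The set of forward Bregman circumcenters of $\mathcal S$ is $\operatorname{aff}(\mathcal S)\cap\overrightarrow E_f(\mathcal S)$. For $y\in\operatorname{int}\operatorname{dom} f$ the backward Bregman projections of $y$ onto a nonempty set $C$ are the points $u\in C\cap\operatorname{dom} f$ with $D_f(u,y)\le D_f(c,y)$ for all $c\in C$. Let $y\in\overrightarrow E_f(\mathcal S)$. Then: (i) $\operatorname{aff}(\mathcal S)\cap\overrightarrow E_f(\mathcal S)=\operatorname{aff}(\mathcal S)\cap\operatorname{int}\operatorname{dom} f\cap\nabla f^*\bigl(\nabla f(y)+M^\perp\bigr)$, where $\nabla f^*(A)$ means $\{\nabla f^*(w): w\in A\cap\operatorname{int}\operatorname{dom} f^*\}$. (ii) If $\operatorname{aff}(\mathcal S)\cap\operatorname{int}\operatorname{dom} f\neq\varnothing$ (which is the case, for example, if $\operatorname{dom}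 f=\mathcal H$ or $\mathcal S\cap\operatorname{int}\operatorname{dom} f\neq\varnothing$), then $y$ has exactly one backward Bregman projection onto $\operatorname{aff}(\mathcal S)$, and it is a forward Bregman circumcenter of $\mathcal S$. -/

import Mathlib

open Set Filter Topology

noncomputable section

namespace Bregman

variable {H : Type*} [NormedAddCommGroup H] [InnerProductSpace ℝ H]

/-- The effective domain of an extended-real-valued function. -/
def effDom (f : H → EReal) : Set H := {x | f x < ⊤}

/-- The interior of the effective domain. -/
def intDom (f : H → EReal) : Set H := interior (effDom f)

/-- The class `Γ₀(H)`: proper, lower semicontinuous (closed), convex functions with values in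
`]-∞, +∞]`. Convexity is convexity of the epigraph. -/
structure GammaZero (f : H → EReal) : Prop where
  ne_bot : ∀ x, f x ≠ ⊥
  proper : (effDom f).Nonempty
  closed : LowerSemicontinuous f
  convex : Convex ℝ {q : H × ℝ | f q.1 ≤ (q.2 : EReal)}

/-- The Fenchel conjugate `f*(u) = sup_x (⟪x, u⟫ - f x)`. -/
def conjugate (f : H → EReal) (u : H) : EReal :=
  ⨆ x : H, (((inner ℝ x u : ℝ) : EReal) - f x)

/-- The subdifferential of `f` at `x`; for a proper function it is empty off the domain. -/
def subdiff (f : H → EReal) (x : H) : Set H :=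
  {u | ∀ z, f x + ((inner ℝ u (z - x) : ℝ) : EReal) ≤ f z}

/-- The domain of the subdifferential operator. -/
def subdiffDom (f : H → EReal) : Set H := {x | (subdiff f x).Nonempty}

/-- `f` is Gâteaux differentiable at the point `x` of the interior of its domain, with Gâteaux
gradient `u`: the derivative of `f` at `x` in every direction `v` is `⟪u, v⟫`. (The real-valued
function `toReal ∘ f` agrees with `f` near `x` when `f` does not take the value `-∞`.) -/
def HasGateauxGradientAt (f : H → EReal) (u x : H) : Prop :=
  x ∈ intDom f ∧ ∀ v, HasLineDerivAt ℝ (fun z => (f z).toReal) (inner ℝ u v) x v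

/-- Gâteaux gradients are unique. -/
theorem HasGateauxGradientAt.unique {f : H → EReal} {u u' x : H}
    (h : HasGateauxGradientAt f u x) (h' : HasGateauxGradientAt f u' x) : u = u' :=
  ext_inner_right ℝ fun v => HasDerivAt.unique (h.2 v) (h'.2 v)

open Classical in
/-- The Gâteaux gradient `∇f(x)`, with value `0` where `f` is not Gâteaux differentiable. -/
def gradient (f : H → EReal) (x : H) : H :=
  if h : ∃ u, HasGateauxGradientAt f u x then h.choose else 0

theorem HasGateauxGradientAt.gradient_eq {f : H → EReal} {u x : H}
    (h : HasGateauxGradientAt f u x) : gradient f x = u := by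
  have hex : ∃ u, HasGateauxGradientAt f u x := ⟨u, h⟩
  rw [gradient, dif_pos hex]
  exact hex.choose_spec.unique h

/-- The image `∇g(A)` of a set `A` under the gradient mapping of `g`, a mapping which is defined
only at the points of `int dom g` where `g` is Gâteaux differentiable. -/
def gradientImage (g : H → EReal) (A : Set H) : Set H :=
  {x | ∃ w ∈ A, HasGateauxGradientAt g x w}

/-- Essential smoothness. -/
structure EssentiallySmooth (f : H → EReal) : Prop where
  subdiffDom_eq : subdiffDom f = intDom f
  nonempty : (intDom f).Nonempty
  differentiable : ∀ x ∈ intDom f, ∃ u, HasGateauxGradientAt f u x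
  blowup : ∀ (x : ℕ → H) (a : H), (∀ k, x k ∈ intDom f) → a ∈ frontier (effDom f) →
    Tendsto x atTop (𝓝 a) → Tendsto (fun k => ‖gradient f (x k)‖) atTop atTop

/-- Essential strict convexity: the inverse of the subdifferential is locally bounded on its
domain, and `f` is strictly convex on every convex subset of the domain of the subdifferential
(where a proper function is finite). -/
structure EssentiallyStrictlyConvex (f : H → EReal) : Prop where
  locallyBounded : ∀ u : H, (∃ x, u ∈ subdiff f x) →
    ∃ δ > 0, Bornology.IsBounded {x | ∃ v ∈ Metric.closedBall u δ, v ∈ subdiff f x}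
  strictConvex : ∀ C : Set H, C ⊆ subdiffDom f → Convex ℝ C →
    StrictConvexOn ℝ C (fun z => (f z).toReal)

/-- Legendre functions. -/
structure Legendre (f : H → EReal) : Prop where
  smooth : EssentiallySmooth f
  strict : EssentiallyStrictlyConvex f

open Classical in
/-- The Bregman distance associated with `f`. -/
def distance (f : H → EReal) (x y : H) : EReal :=
  if y ∈ intDom f then f x - f y - ((inner ℝ (gradient f y) (x - y) : ℝ) : EReal) else ⊤

/-- The set of backward Bregman projections of `y` onto `C`. -/
def backwardProj (f : H → EReal) (C : Set H) (y : H) : Set H :=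
  {u | u ∈ C ∩ effDom f ∧ ∀ c ∈ C, distance f u y ≤ distance f c y}

/-- The forward equidistant set of `K`: the points `q` of `int dom f` for which `D_f(x, q)` is the
same for all `x ∈ K`. -/
def forwardEquidistant (f : H → EReal) (K : Set H) : Set H :=
  {q | q ∈ intDom f ∧ ∀ x ∈ K, ∀ x' ∈ K, distance f x q = distance f x' q}

/-- The set of forward Bregman circumcenters of `K`. -/
def forwardCircumcenters (f : H → EReal) (K : Set H) : Set H :=
  (affineSpan ℝ K : Set H) ∩ forwardEquidistant f K

end Bregman

end

/-!
Forward equidistance of `q` says `⟪∇f q, p i - p 0⟫ = f (p i) - f (p 0)` for all `i`, a condition on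
`∇f q` modulo `Mᗮ` only. So, given one equidistant point `y`, the others are the interior points `q`
with `∇f q ∈ ∇f y + Mᗮ` (`mem_forwardEquidistant_iff`), and the description of the circumcenters
follows because `∇f* = (∇f)⁻¹` on `int dom f` (`Legendre.hasGateauxGradientAt_conjugate_iff`).

The analytic core is that `f*` is bounded above near every point of the range of `∂f`
(`EssentiallyStrictlyConvex.exists_conjugate_bound`), deduced from the local boundedness of `(∂f)⁻¹`
by solving resolvent equations. Hence `f - ⟪w, ·⟫` grows linearly for `w` in the range of `∂f`,
so that its sublevel sets are bounded. With the weak compactness of bounded closed convex sets, in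
the elementary form `nonempty_iInter_of_antitone`, this gives both the differentiability of `f*` at
`w` and the existence of backward projections.

A backward projection of `y` minimizes `f - ⟪∇f y, ·⟫` on the affine hull. By the blow-up of `∇f` at
the boundary it is interior (`Legendre.mem_intDom_of_isMin`), so that strict convexity makes it
unique, and the first-order condition `∇f z - ∇f y ∈ Mᗮ` makes it equidistant.
-/

namespace Bregman

/-! ### Real values of an extended-real-valued convex function -/

theorem coe_toReal {H : Type*} {f : H → EReal} (hbot : ∀ x, f x ≠ ⊥) {x : H} (hx : x ∈ effDom f) :
    ((f x).toReal : EReal) = f x :=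
  EReal.coe_toReal (ne_of_lt hx) (hbot x)

theorem le_coe_iff {H : Type*} {f : H → EReal} (hbot : ∀ x, f x ≠ ⊥) {x : H} {c : ℝ} :
    f x ≤ (c : EReal) ↔ x ∈ effDom f ∧ (f x).toReal ≤ c := by
  constructor
  · intro h
    have hx : x ∈ effDom f := lt_of_le_of_lt h (EReal.coe_lt_top c)
    refine ⟨hx, ?_⟩
    rwa [← coe_toReal hbot hx, EReal.coe_le_coe_iff] at h
  · rintro ⟨hx, h⟩
    rwa [← coe_toReal hbot hx, EReal.coe_le_coe_iff]

theorem intDom_subset {H : Type*} [NormedAddCommGroup H] (f : H → EReal) :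
    intDom f ⊆ effDom f := interior_subset

variable {H : Type*} [NormedAddCommGroup H] [InnerProductSpace ℝ H]

theorem convexOn_toReal {f : H → EReal} (hbot : ∀ x, f x ≠ ⊥)
    (hconv : Convex ℝ {q : H × ℝ | f q.1 ≤ (q.2 : EReal)}) :
    ConvexOn ℝ (effDom f) fun x => (f x).toReal := by
  have key : ∀ x ∈ effDom f, ∀ y ∈ effDom f, ∀ a b : ℝ, 0 ≤ a → 0 ≤ b → a + b = 1 →
      f (a • x + b • y) ≤ ((a * (f x).toReal + b * (f y).toReal : ℝ) : EReal) := by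
    intro x hx y hy a b ha hb hab
    have := @hconv (x, (f x).toReal) (coe_toReal hbot hx).ge
      (y, (f y).toReal) (coe_toReal hbot hy).ge a b ha hb hab
    simpa using this
  refine ⟨fun x hx y hy a b ha hb hab => ?_, fun x hx y hy a b ha hb hab => ?_⟩
  · exact ((le_coe_iff hbot).1 (key x hx y hy a b ha hb hab)).1
  · exact ((le_coe_iff hbot).1 (key x hx y hy a b ha hb hab)).2

theorem GammaZero.convexOn {f : H → EReal} (hf : GammaZero f) :
    ConvexOn ℝ (effDom f) fun x => (f x).toReal :=
  convexOn_toReal hf.ne_bot hf.convex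

/-- Sublevel sets of `f + h` are closed for continuous `h`, as preimages of the epigraph of `f`. -/
theorem GammaZero.isClosed_sublevel {f : H → EReal} (hf : GammaZero f) {h : H → ℝ}
    (hh : Continuous h) (c : ℝ) :
    IsClosed {x | x ∈ effDom f ∧ (f x).toReal + h x ≤ c} := by
  have h1 : IsClosed {x : H | f x ≤ ((c - h x : ℝ) : EReal)} :=
    hf.closed.isClosed_epigraph.preimage
      (continuous_id.prodMk (continuous_coe_real_ereal.comp (continuous_const.sub hh)))
  convert h1 using 2
  ext x
  rw [le_coe_iff hf.ne_bot, le_sub_iff_add_le]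

theorem GammaZero.convex_sublevel {f : H → EReal} (hf : GammaZero f) {h : H → ℝ}
    (hh : ConvexOn ℝ univ h) (c : ℝ) :
    Convex ℝ {x | x ∈ effDom f ∧ (f x).toReal + h x ≤ c} :=
  (hf.convexOn.add (hh.subset (subset_univ _) hf.convexOn.1)).convex_le c

/-! ### Subgradients and Gâteaux gradients -/

theorem mem_subdiff_iff {f : H → EReal} (hbot : ∀ x, f x ≠ ⊥) {x u : H} (hx : x ∈ effDom f) :
    u ∈ subdiff f x ↔ ∀ z ∈ effDom f, (f x).toReal + inner ℝ u (z - x) ≤ (f z).toReal := by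
  constructor
  · intro h z hz
    have := h z
    rwa [← coe_toReal hbot hx, ← coe_toReal hbot hz, ← EReal.coe_add,
      EReal.coe_le_coe_iff] at this
  · intro h z
    by_cases hz : z ∈ effDom f
    · rw [← coe_toReal hbot hx, ← coe_toReal hbot hz, ← EReal.coe_add, EReal.coe_le_coe_iff]
      exact h z hz
    · have : f z = ⊤ := by simpa [effDom] using hz
      rw [this]; exact le_top

theorem mem_effDom_of_mem_subdiff {f : H → EReal} (hf : (effDom f).Nonempty) {x u : H}
    (h : u ∈ subdiff f x) : x ∈ effDom f := by
  obtain ⟨z, hz⟩ := hf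
  by_contra hx
  have hx' : f x = ⊤ := by simpa [effDom] using hx
  have := h z
  rw [hx', EReal.top_add_coe, top_le_iff] at this
  exact (ne_of_lt hz) this

theorem HasGateauxGradientAt.mem_subdiff {f : H → EReal} (hbot : ∀ x, f x ≠ ⊥)
    (hconv : Convex ℝ {q : H × ℝ | f q.1 ≤ (q.2 : EReal)}) {u x : H}
    (h : HasGateauxGradientAt f u x) : u ∈ subdiff f x := by
  have hx := intDom_subset f h.1
  rw [mem_subdiff_iff hbot hx]
  intro z hz
  have hd := (h.2 (z - x)).tendsto_slope_zero_right
  have hle : ∀ᶠ t : ℝ in 𝓝[>] 0,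
      t⁻¹ • ((f (x + t • (z - x))).toReal - (f x).toReal) ≤ (f z).toReal - (f x).toReal := by
    filter_upwards [Ioo_mem_nhdsGT (zero_lt_one : (0 : ℝ) < 1)] with t ht
    have hc := (convexOn_toReal hbot hconv).2 hx hz (sub_nonneg.2 ht.2.le) ht.1.le
      (sub_add_cancel 1 t)
    have hp : (1 - t) • x + t • z = x + t • (z - x) := by module
    rw [hp] at hc
    simp only [smul_eq_mul] at hc ⊢
    rw [inv_mul_le_iff₀ ht.1]
    linarith
  have := le_of_tendsto (by simpa using hd) hle
  linarith

/-- At a point of Gâteaux differentiability the gradient is the only subgradient. -/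
theorem HasGateauxGradientAt.eq_of_mem_subdiff {f : H → EReal} (hbot : ∀ x, f x ≠ ⊥) {u w x : H}
    (h : HasGateauxGradientAt f u x) (hw : w ∈ subdiff f x) : w = u := by
  have hx := intDom_subset f h.1
  rw [mem_subdiff_iff hbot hx] at hw
  refine ext_inner_right ℝ fun v => ?_
  have hd : HasDerivAt (fun t : ℝ => (f (x + t • v)).toReal - t * inner ℝ w v)
      (inner ℝ u v - 1 * inner ℝ w v) 0 :=
    HasDerivAt.sub (h.2 v) ((hasDerivAt_id (0 : ℝ)).mul_const _)
  have hmin : IsLocalMin (fun t : ℝ => (f (x + t • v)).toReal - t * inner ℝ w v) 0 := by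
    have hc : ContinuousAt (fun t : ℝ => x + t • v) 0 := by fun_prop
    have hn : effDom f ∈ 𝓝 (x + (0 : ℝ) • v) := by
      simpa using mem_interior_iff_mem_nhds.1 h.1
    filter_upwards [hc hn] with t ht
    have := hw _ ht
    simp only [add_sub_cancel_left, inner_smul_right] at this
    simp only [zero_smul, add_zero, zero_mul, sub_zero]
    linarith
  have := hmin.hasDerivAt_eq_zero hd
  linarith

theorem Legendre.hasGateauxGradientAt {f : H → EReal} (hL : Legendre f) {x : H}
    (hx : x ∈ intDom f) : HasGateauxGradientAt f (gradient f x) x := by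
  obtain ⟨u, hu⟩ := hL.smooth.differentiable x hx
  rwa [hu.gradient_eq]

theorem Legendre.gradient_mem_subdiff {f : H → EReal} (hf : GammaZero f) (hL : Legendre f) {x : H}
    (hx : x ∈ intDom f) : gradient f x ∈ subdiff f x :=
  (hL.hasGateauxGradientAt hx).mem_subdiff hf.ne_bot hf.convex

/-- Essential strict convexity makes `(∂f)⁻¹` single-valued: a common subgradient at two points
is a subgradient on the whole segment between them, on which `f` is then affine. -/
theorem EssentiallyStrictlyConvex.eq_of_mem_subdiff {f : H → EReal} (hf : GammaZero f)
    (hs : EssentiallyStrictlyConvex f) {u x z : H} (hx : u ∈ subdiff f x)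
    (hz : u ∈ subdiff f z) : x = z := by
  by_contra hne
  have hxd := mem_effDom_of_mem_subdiff hf.proper hx
  have hzd := mem_effDom_of_mem_subdiff hf.proper hz
  have hx1 := (mem_subdiff_iff hf.ne_bot hxd).1 hx
  have hz1 := (mem_subdiff_iff hf.ne_bot hzd).1 hz
  have e1 := hx1 z hzd
  have e2 := hz1 x hxd
  have e3 : inner ℝ u (x - z) = - inner ℝ u (z - x) := by rw [← inner_neg_right, neg_sub]
  have hseg : segment ℝ x z ⊆ subdiffDom f := by
    rintro _ ⟨a, b, ha, hb, hab, rfl⟩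
    have hd := hf.convexOn.1 hxd hzd ha hb hab
    refine ⟨u, (mem_subdiff_iff hf.ne_bot hd).2 fun y hy => ?_⟩
    have hc := hf.convexOn.2 hxd hzd ha hb hab
    simp only [smul_eq_mul] at hc
    have hb1 := hx1 y hy
    have hb2 := hz1 y hy
    have e4 : inner ℝ u (y - (a • x + b • z))
        = a * inner ℝ u (y - x) + b * inner ℝ u (y - z) := by
      rw [← inner_smul_right, ← inner_smul_right, ← inner_add_right]
      congr 1
      obtain rfl : a = 1 - b := by linarith
      module
    have m1 := mul_le_mul_of_nonneg_left hb1 ha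
    have m2 := mul_le_mul_of_nonneg_left hb2 hb
    have e5 : a * (f y).toReal + b * (f y).toReal = (f y).toReal := by
      rw [← add_mul, hab, one_mul]
    rw [e4]
    linarith
  have hst := (hs.strictConvex _ hseg (convex_segment x z)).2 (left_mem_segment ℝ x z)
    (right_mem_segment ℝ x z) hne one_half_pos one_half_pos (add_halves 1)
  have hm := hx1 _ (hf.convexOn.1 hxd hzd one_half_pos.le one_half_pos.le (add_halves 1))
  have e6 : ((1 / 2 : ℝ) • x + (1 / 2 : ℝ) • z) - x = (1 / 2 : ℝ) • (z - x) := by module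
  rw [e6, inner_smul_right] at hm
  simp only [smul_eq_mul] at hst
  linarith

/-! ### Minimization of convex functions on a Hilbert space -/

/-- Weak compactness of bounded closed convex sets, for decreasing sequences: the points of minimal
norm have bounded increasing norms, hence form a Cauchy sequence. -/
theorem nonempty_iInter_of_antitone [CompleteSpace H] {C : ℕ → Set H} (hanti : Antitone C)
    (hne : ∀ k, (C k).Nonempty) (hcl : ∀ k, IsClosed (C k)) (hconv : ∀ k, Convex ℝ (C k))
    (hb : Bornology.IsBounded (C 0)) : (⋂ k, C k).Nonempty := by
  have hex : ∀ k, ∃ a ∈ C k, ∀ x ∈ C k, ‖a‖ ^ 2 + ‖x - a‖ ^ 2 ≤ ‖x‖ ^ 2 := by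
    intro k
    obtain ⟨a, ha, hmin⟩ :=
      exists_norm_eq_iInf_of_complete_convex (hne k) (hcl k).isComplete (hconv k) 0
    rw [norm_eq_iInf_iff_real_inner_le_zero (hconv k) ha] at hmin
    refine ⟨a, ha, fun x hx => ?_⟩
    have h1 := hmin x hx
    rw [zero_sub, inner_neg_left] at h1
    have h2 := norm_add_sq_real a (x - a)
    rw [add_sub_cancel] at h2
    linarith
  choose a ha hmin using hex
  obtain ⟨R, hR⟩ := hb.exists_norm_le
  have hmono : Monotone fun k => ‖a k‖ ^ 2 := by
    intro k l hkl
    have := hmin k (a l) (hanti hkl (ha l))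
    have h0 := sq_nonneg ‖a l - a k‖
    simp only
    linarith
  have hbdd : BddAbove (range fun k => ‖a k‖ ^ 2) := by
    refine ⟨R ^ 2, ?_⟩
    rintro _ ⟨k, rfl⟩
    exact pow_le_pow_left₀ (norm_nonneg _) (hR _ (hanti (Nat.zero_le k) (ha k))) 2
  have hlim := tendsto_atTop_ciSup hmono hbdd
  set L := ⨆ k, ‖a k‖ ^ 2
  have hcauchy : CauchySeq a := by
    refine cauchySeq_of_le_tendsto_0' (fun k => √(L - ‖a k‖ ^ 2)) (fun k l hkl => ?_) ?_
    · have h1 := hmin k (a l) (hanti hkl (ha l))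
      have h2 : ‖a l‖ ^ 2 ≤ L := le_ciSup hbdd l
      rw [dist_comm, dist_eq_norm]
      exact Real.le_sqrt_of_sq_le (by linarith)
    · have : Tendsto (fun k => √(L - ‖a k‖ ^ 2)) atTop (𝓝 √(L - L)) :=
        (hlim.const_sub L).sqrt
      simpa using this
  obtain ⟨x, hx⟩ := cauchySeq_tendsto_of_complete hcauchy
  refine ⟨x, mem_iInter.2 fun k => (hcl k).mem_of_tendsto hx ?_⟩
  filter_upwards [eventually_ge_atTop k] with l hl using hanti hl (ha l)

/-- The direct method: the minimizers form the intersection of the sublevel sets at the levels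
`inf φ + 1 / (k + 1)`. -/
theorem exists_isMinOn_of_sublevel [CompleteSpace H] {D : Set H} {φ : H → ℝ} (hD : D.Nonempty)
    (hbelow : BddBelow (φ '' D)) (hcl : ∀ c, IsClosed {x | x ∈ D ∧ φ x ≤ c})
    (hconv : ∀ c, Convex ℝ {x | x ∈ D ∧ φ x ≤ c})
    (hbdd : ∀ c, Bornology.IsBounded {x | x ∈ D ∧ φ x ≤ c}) :
    ∃ z ∈ D, ∀ x ∈ D, φ z ≤ φ x := by
  set μ := sInf (φ '' D)
  have hne : ∀ k : ℕ, {x | x ∈ D ∧ φ x ≤ μ + 1 / ((k : ℝ) + 1)}.Nonempty := by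
    intro k
    obtain ⟨_, ⟨x, hx, rfl⟩, hlt⟩ := exists_lt_of_csInf_lt (hD.image φ)
      (lt_add_of_pos_right μ (Nat.one_div_pos_of_nat (n := k) (α := ℝ)))
    exact ⟨x, hx, hlt.le⟩
  obtain ⟨z, hz⟩ := nonempty_iInter_of_antitone
    (C := fun k : ℕ => {x | x ∈ D ∧ φ x ≤ μ + 1 / ((k : ℝ) + 1)})
    (fun k l hkl x hx => ⟨hx.1, hx.2.trans (by
      simpa using Nat.one_div_le_one_div (α := ℝ) hkl)⟩)
    hne (fun k => hcl _) (fun k => hconv _) (hbdd _)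
  rw [mem_iInter] at hz
  have hzμ : φ z ≤ μ := by
    have ht : Tendsto (fun k : ℕ => μ + 1 / ((k : ℝ) + 1)) atTop (𝓝 (μ + 0)) :=
      tendsto_one_div_add_atTop_nhds_zero_nat.const_add μ
    rw [add_zero] at ht
    exact ge_of_tendsto' ht fun k => (hz k).2
  exact ⟨z, (hz 0).1, fun x hx => hzμ.trans (csInf_le hbelow (mem_image_of_mem φ hx))⟩

/-- Resolvent equation for `∂f`: minimize `f - ⟪v, ·⟫ + (s / 2) ‖· - q‖ ^ 2`. -/
theorem GammaZero.exists_resolvent [CompleteSpace H] {f : H → EReal} (hf : GammaZero f) {q w : H}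
    (hw : w ∈ subdiff f q) (v : H) {s : ℝ} (hs : 0 < s) :
    ∃ x, v - s • (x - q) ∈ subdiff f x := by
  have hq := mem_effDom_of_mem_subdiff hf.proper hw
  have hw1 := (mem_subdiff_iff hf.ne_bot hq).1 hw
  set h : H → ℝ := fun x => s / 2 * ‖x - q‖ ^ 2 - inner ℝ v (x - q) with hh
  have hcont : Continuous h := by fun_prop
  have hexp : ∀ (x d : H) (t : ℝ), h (x + t • d)
      = h x + t * (s * inner ℝ (x - q) d - inner ℝ v d) + s / 2 * t ^ 2 * ‖d‖ ^ 2 := by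
    intro x d t
    have e1 : x + t • d - q = (x - q) + t • d := by abel
    simp only [hh]
    rw [e1, norm_add_sq_real, inner_add_right, inner_smul_right, inner_smul_right, norm_smul,
      mul_pow, Real.norm_eq_abs, sq_abs]
    ring
  have hconvex : ConvexOn ℝ univ h := by
    refine ⟨convex_univ, fun x _ y _ a b ha hb hab => ?_⟩
    obtain rfl : a = 1 - b := by linarith
    have e1 : (1 - b) • x + b • y = x + b • (y - x) := by module
    have e2 := hexp x (y - x) 1
    rw [one_smul, add_sub_cancel] at e2
    rw [e1, hexp, e2, smul_eq_mul, smul_eq_mul]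
    have : 0 ≤ (1 - b) * b * (s / 2 * ‖y - x‖ ^ 2) := by positivity
    linarith
  have hlow : ∀ x ∈ effDom f, (f q).toReal - ‖w - v‖ * ‖x - q‖ + s / 2 * ‖x - q‖ ^ 2
      ≤ (f x).toReal + h x := by
    intro x hx
    have h1 := hw1 x hx
    have h2 := neg_le_of_abs_le (abs_real_inner_le_norm (w - v) (x - q))
    rw [inner_sub_left] at h2
    simp only [hh]
    linarith
  obtain ⟨x, hx, hmin⟩ := exists_isMinOn_of_sublevel (φ := fun x => (f x).toReal + h x) ⟨q, hq⟩
    (by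
      refine ⟨(f q).toReal - ‖w - v‖ ^ 2 / (2 * s), ?_⟩
      rintro _ ⟨x, hx, rfl⟩
      refine le_trans ?_ (hlow x hx)
      have : ‖w - v‖ ^ 2 / (2 * s) - ‖w - v‖ * ‖x - q‖ + s / 2 * ‖x - q‖ ^ 2
          = s / 2 * (‖x - q‖ - ‖w - v‖ / s) ^ 2 := by field_simp; ring
      have h0 : 0 ≤ s / 2 * (‖x - q‖ - ‖w - v‖ / s) ^ 2 := by positivity
      linarith)
    (hf.isClosed_sublevel hcont) (hf.convex_sublevel hconvex)
    (by
      intro c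
      refine (Metric.isBounded_closedBall (x := q)
        (r := 1 + 2 / s * (‖w - v‖ + |c - (f q).toReal|))).subset ?_
      rintro x ⟨hx, hxc⟩
      rw [Metric.mem_closedBall, dist_eq_norm]
      have h1 := (hlow x hx).trans hxc
      have h2 := le_abs_self (c - (f q).toReal)
      by_contra! hlt
      have h3 : 1 ≤ ‖x - q‖ := by
        have : 0 ≤ 2 / s * (‖w - v‖ + |c - (f q).toReal|) := by positivity
        linarith
      have h4 : ‖w - v‖ + |c - (f q).toReal| < s / 2 * ‖x - q‖ := by
        have h5 : 2 / s * (‖w - v‖ + |c - (f q).toReal|) < ‖x - q‖ := by linarith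
        have h6 := mul_lt_mul_of_pos_left h5 (half_pos hs)
        have h7 : s / 2 * (2 / s * (‖w - v‖ + |c - (f q).toReal|))
            = ‖w - v‖ + |c - (f q).toReal| := by field_simp
        linarith
      have h5 := mul_lt_mul_of_pos_right h4 (lt_of_lt_of_le one_pos h3)
      have h6 := le_mul_of_one_le_right (abs_nonneg (c - (f q).toReal)) h3
      nlinarith)
  refine ⟨x, (mem_subdiff_iff hf.ne_bot hx).2 fun z hz => ?_⟩
  -- Compare `x` with the points `x + t • (z - x)` and let `t` tend to `0`.
  have key : ∀ᶠ t : ℝ in 𝓝[>] 0, (f x).toReal + inner ℝ (v - s • (x - q)) (z - x)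
      - s / 2 * t * ‖z - x‖ ^ 2 ≤ (f z).toReal := by
    filter_upwards [Ioo_mem_nhdsGT (zero_lt_one : (0 : ℝ) < 1)] with t ht
    have hp : (1 - t) • x + t • z = x + t • (z - x) := by module
    have h01 := sub_nonneg.2 ht.2.le
    have hd := hf.convexOn.1 hx hz h01 ht.1.le (sub_add_cancel 1 t)
    have hc := hf.convexOn.2 hx hz h01 ht.1.le (sub_add_cancel 1 t)
    rw [hp] at hd hc
    have hm := hmin _ hd
    rw [hexp] at hm
    simp only [smul_eq_mul] at hc
    rw [inner_sub_left, real_inner_smul_left]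
    refine le_of_mul_le_mul_left ?_ ht.1
    linarith
  have hlim : Tendsto (fun t : ℝ => (f x).toReal + inner ℝ (v - s • (x - q)) (z - x)
      - s / 2 * t * ‖z - x‖ ^ 2) (𝓝[>] 0)
      (𝓝 ((f x).toReal + inner ℝ (v - s • (x - q)) (z - x) - s / 2 * 0 * ‖z - x‖ ^ 2)) := by
    refine Tendsto.mono_left (Continuous.tendsto ?_ 0) nhdsWithin_le_nhds
    fun_prop
  have := le_of_tendsto hlim key
  simpa using this

/-! ### Boundedness of the conjugate near subgradients -/

/-- The conjugate `f*` is bounded above near each point `w` of the range of `∂f`. For `v` near `w`,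
monotonicity of `∂f` keeps the subgradients `v - s • (x - q)` given by the resolvent equation in
the ball on which `(∂f)⁻¹` is bounded, whatever `s` is; then `s` tends to `0`. -/
theorem EssentiallyStrictlyConvex.exists_conjugate_bound [CompleteSpace H] {f : H → EReal}
    (hf : GammaZero f) (hs : EssentiallyStrictlyConvex f) {q w : H} (hw : w ∈ subdiff f q) :
    ∃ δ > 0, ∃ C : ℝ, ∀ v ∈ Metric.closedBall w δ, ∀ x ∈ effDom f,
      inner ℝ x v - (f x).toReal ≤ C := by
  obtain ⟨δ, hδ, hB⟩ := hs.locallyBounded w ⟨q, hw⟩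
  obtain ⟨R, hR⟩ := hB.exists_norm_le
  have hq := mem_effDom_of_mem_subdiff hf.proper hw
  have hw1 := (mem_subdiff_iff hf.ne_bot hq).1 hw
  have hqR : ‖q‖ ≤ R := hR q ⟨w, Metric.mem_closedBall_self hδ.le, hw⟩
  refine ⟨δ / 2, half_pos hδ, -(f q).toReal + ‖w‖ * (2 * R) + (‖w‖ + δ) * R, fun v hv x hx => ?_⟩
  rw [Metric.mem_closedBall, dist_eq_norm] at hv
  have key : ∀ s : ℝ, 0 < s → inner ℝ x v - (f x).toReal ≤
      -(f q).toReal + ‖w‖ * (2 * R) + (‖w‖ + δ) * R + s * (‖x‖ * (2 * R)) := by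
    intro s hs0
    obtain ⟨z, hz⟩ := hf.exists_resolvent hw v hs0
    have hzd := mem_effDom_of_mem_subdiff hf.proper hz
    have hz1 := (mem_subdiff_iff hf.ne_bot hzd).1 hz
    have h1 := hw1 z hzd
    have h2 := hz1 q hq
    have hsz : s * ‖z - q‖ ≤ ‖v - w‖ := by
      rw [← neg_sub z q, inner_neg_right, inner_sub_left, real_inner_smul_left,
        real_inner_self_eq_norm_sq] at h2
      have h3 := real_inner_le_norm (v - w) (z - q)
      rw [inner_sub_left] at h3
      rcases (norm_nonneg (z - q)).eq_or_lt' with h0 | h0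
      · rw [h0, mul_zero]; exact norm_nonneg _
      · refine le_of_mul_le_mul_right ?_ h0
        linarith
    have hvz : ‖v - s • (z - q) - w‖ ≤ δ := by
      have e : v - s • (z - q) - w = (v - w) - s • (z - q) := by abel
      have h3 := norm_sub_le (v - w) (s • (z - q))
      rw [norm_smul, Real.norm_of_nonneg hs0.le] at h3
      rw [e]
      linarith
    have hzR : ‖z‖ ≤ R := hR z ⟨_, by rwa [Metric.mem_closedBall, dist_eq_norm], hz⟩
    have hzq : ‖z - q‖ ≤ 2 * R := (norm_sub_le z q).trans (by linarith)
    have h3 := hz1 x hx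
    have h4 : -(‖w‖ * (2 * R)) ≤ inner ℝ w (z - q) :=
      (neg_le_neg (mul_le_mul_of_nonneg_left hzq (norm_nonneg w))).trans
        (neg_le_of_abs_le (abs_real_inner_le_norm w (z - q)))
    have h5 : inner ℝ (v - s • (z - q)) z ≤ (‖w‖ + δ) * R := by
      refine (real_inner_le_norm _ _).trans (mul_le_mul ?_ hzR (norm_nonneg _) (by positivity))
      have := norm_sub_norm_le (v - s • (z - q)) w
      linarith
    have h6 : inner ℝ x (s • (z - q)) ≤ s * (‖x‖ * (2 * R)) := by
      rw [inner_smul_right]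
      exact mul_le_mul_of_nonneg_left ((real_inner_le_norm _ _).trans
        (mul_le_mul_of_nonneg_left hzq (norm_nonneg x))) hs0.le
    have h7 : inner ℝ (v - s • (z - q)) x = inner ℝ x v - inner ℝ x (s • (z - q)) := by
      rw [real_inner_comm, inner_sub_right]
    rw [inner_sub_right, h7] at h3
    linarith
  have hlim : Tendsto (fun s : ℝ => -(f q).toReal + ‖w‖ * (2 * R) + (‖w‖ + δ) * R
      + s * (‖x‖ * (2 * R))) (𝓝[>] 0)
      (𝓝 (-(f q).toReal + ‖w‖ * (2 * R) + (‖w‖ + δ) * R + 0 * (‖x‖ * (2 * R)))) := by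
    refine Tendsto.mono_left (Continuous.tendsto ?_ 0) nhdsWithin_le_nhds
    fun_prop
  have := ge_of_tendsto hlim (eventually_mem_nhdsWithin.mono key)
  simpa using this

/-- Coercivity of `f - ⟪w, ·⟫`: use the bound on `f*` at the point of the sphere of radius `δ` around
`w` in the direction of `x`. -/
theorem EssentiallyStrictlyConvex.exists_linear_growth [CompleteSpace H] {f : H → EReal}
    (hf : GammaZero f) (hs : EssentiallyStrictlyConvex f) {q w : H} (hw : w ∈ subdiff f q) :
    ∃ δ > 0, ∃ C : ℝ, ∀ x ∈ effDom f, δ * ‖x‖ ≤ (f x).toReal - inner ℝ w x + C := by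
  obtain ⟨δ, hδ, C, hC⟩ := hs.exists_conjugate_bound hf hw
  refine ⟨δ, hδ, C, fun x hx => ?_⟩
  have hmem : w + (δ / ‖x‖) • x ∈ Metric.closedBall w δ := by
    rw [Metric.mem_closedBall, dist_eq_norm, add_sub_cancel_left, norm_smul, norm_div, norm_norm,
      Real.norm_of_nonneg hδ.le]
    rcases eq_or_ne ‖x‖ 0 with h0 | h0
    · simpa [h0] using hδ.le
    · rw [div_mul_cancel₀ _ h0]
  have h1 := hC _ hmem x hx
  have h2 : δ / ‖x‖ * ‖x‖ ^ 2 = δ * ‖x‖ := by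
    rcases eq_or_ne ‖x‖ 0 with h0 | h0
    · simp [h0]
    · field_simp
  rw [inner_add_right, inner_smul_right, real_inner_self_eq_norm_sq, h2, real_inner_comm] at h1
  linarith

/-! ### Gâteaux differentiability of the conjugate -/

theorem conjugate_le_coe_iff {f : H → EReal} (hbot : ∀ x, f x ≠ ⊥) {u : H} {c : ℝ} :
    conjugate f u ≤ (c : EReal) ↔ ∀ x ∈ effDom f, inner ℝ x u - (f x).toReal ≤ c := by
  rw [conjugate, iSup_le_iff]
  refine forall_congr' fun x => ?_
  by_cases hx : x ∈ effDom f
  · rw [← coe_toReal hbot hx, ← EReal.coe_sub, EReal.coe_le_coe_iff]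
    simp [hx]
  · have : f x = ⊤ := by simpa [effDom] using hx
    simp [this, hx]

theorem GammaZero.conjugate_ne_bot {f : H → EReal} (hf : GammaZero f) (u : H) :
    conjugate f u ≠ ⊥ := by
  obtain ⟨x, hx⟩ := hf.proper
  have h : ((inner ℝ x u : ℝ) : EReal) - f x ≤ conjugate f u :=
    le_iSup (fun x : H => ((inner ℝ x u : ℝ) : EReal) - f x) x
  rw [← coe_toReal hf.ne_bot hx, ← EReal.coe_sub] at h
  exact ne_of_gt (lt_of_lt_of_le (EReal.bot_lt_coe _) h)

theorem GammaZero.toReal_conjugate_le_iff {f : H → EReal} (hf : GammaZero f) {u : H} {c : ℝ}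
    (hu : u ∈ effDom (conjugate f)) :
    (conjugate f u).toReal ≤ c ↔ ∀ x ∈ effDom f, inner ℝ x u - (f x).toReal ≤ c := by
  rw [← conjugate_le_coe_iff hf.ne_bot, le_coe_iff hf.conjugate_ne_bot]
  simp [hu]

theorem convex_epigraph_conjugate {f : H → EReal} (hbot : ∀ x, f x ≠ ⊥) :
    Convex ℝ {q : H × ℝ | conjugate f q.1 ≤ (q.2 : EReal)} := by
  rintro ⟨u, r⟩ hu ⟨v, s⟩ hv a b ha hb hab
  rw [mem_ofPred_eq, conjugate_le_coe_iff hbot] at hu hv ⊢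
  intro x hx
  have h1 := mul_le_mul_of_nonneg_left (hu x hx) ha
  have h2 := mul_le_mul_of_nonneg_left (hv x hx) hb
  obtain rfl : a = 1 - b := by linarith
  simp only [Prod.fst_add, Prod.smul_fst, Prod.snd_add, Prod.smul_snd, smul_eq_mul,
    inner_add_right, inner_smul_right] at h1 h2 ⊢
  linarith

/-- Equality in the Fenchel–Young inequality. -/
theorem GammaZero.toReal_conjugate_eq {f : H → EReal} (hf : GammaZero f) {q w : H}
    (hw : w ∈ subdiff f q) :
    w ∈ effDom (conjugate f) ∧ (conjugate f w).toReal = inner ℝ q w - (f q).toReal := by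
  have hq := mem_effDom_of_mem_subdiff hf.proper hw
  have hw1 := (mem_subdiff_iff hf.ne_bot hq).1 hw
  have hle : ∀ x ∈ effDom f, inner ℝ x w - (f x).toReal ≤ inner ℝ q w - (f q).toReal := by
    intro x hx
    have := hw1 x hx
    rw [inner_sub_right, real_inner_comm, real_inner_comm q] at this
    linarith
  obtain ⟨hd, h1⟩ := (le_coe_iff hf.conjugate_ne_bot).1 ((conjugate_le_coe_iff hf.ne_bot).2 hle)
  exact ⟨hd, le_antisymm h1 ((hf.toReal_conjugate_le_iff hd).1 le_rfl q hq)⟩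

/-- One-sided upper bound for the difference quotients of `f*` at `w`. If it failed, the nonempty
nested sets of points `x` with `⟪x - q, v⟫ ≥ ε` that almost minimize `f - ⟪w, ·⟫` would have a
common point: a second minimizer besides `q`. -/
theorem EssentiallyStrictlyConvex.conjugate_slope_bound [CompleteSpace H] {f : H → EReal}
    (hf : GammaZero f) (hs : EssentiallyStrictlyConvex f) {q w : H} (hw : w ∈ subdiff f q)
    (v : H) {ε : ℝ} (hε : 0 < ε) :
    ∃ τ > 0, ∀ t ∈ Ioo 0 τ, ∀ x ∈ effDom f, inner ℝ x (w + t • v) - (f x).toReal ≤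
      inner ℝ q w - (f q).toReal + t * (inner ℝ q v + ε) := by
  by_contra! hcon
  have hq := mem_effDom_of_mem_subdiff hf.proper hw
  have hw1 := (mem_subdiff_iff hf.ne_bot hq).1 hw
  obtain ⟨δ, hδ, C, hC⟩ := hs.exists_linear_growth hf hw
  set g : H → ℝ := fun x => (f x).toReal - (f q).toReal - inner ℝ w (x - q) with hg
  have hg0 : ∀ x ∈ effDom f, 0 ≤ g x := fun x hx => by
    have := hw1 x hx
    simp only [hg]; linarith
  set B : ℝ := (f q).toReal - inner ℝ w q + C with hB
  have hgrow : ∀ x ∈ effDom f, ‖x‖ ≤ (g x + B) / δ := fun x hx => by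
    rw [le_div_iff₀ hδ]
    have := hC x hx
    simp only [hg, hB, inner_sub_right]; linarith
  set K : ℝ := ‖v‖ * (1 / δ + |B| / δ + ‖q‖) + 1 with hK
  have hK0 : 0 < K := by positivity
  have hv : ∀ x ∈ effDom f, inner ℝ (x - q) v ≤ K * (g x + 1) := fun x hx => by
    have h1 : ‖x - q‖ ≤ (1 / δ + |B| / δ + ‖q‖) * (g x + 1) := by
      have h2 := norm_sub_le x q
      have h3 := hgrow x hx
      have h4 : (g x + B) / δ ≤ (1 / δ + |B| / δ) * (g x + 1) := by
        rw [← add_div, div_mul_eq_mul_div]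
        refine div_le_div_of_nonneg_right ?_ hδ.le
        have := mul_nonneg (abs_nonneg B) (hg0 x hx)
        have := le_abs_self B
        linarith
      have := mul_nonneg (norm_nonneg q) (hg0 x hx)
      linarith
    have h2 := real_inner_le_norm (x - q) v
    have h3 := mul_le_mul_of_nonneg_right h1 (norm_nonneg v)
    have := hg0 x hx
    simp only [hK]
    linarith
  set h : H → ℝ := fun x => -(f q).toReal - inner ℝ w (x - q) with hh
  have hgh : ∀ x, g x = (f x).toReal + h x := fun x => by simp only [hg, hh]; ring
  have hcont : Continuous h := by fun_prop
  have hconv : ConvexOn ℝ univ h := by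
    refine ⟨convex_univ, fun x _ z _ a b ha hb hab => le_of_eq ?_⟩
    obtain rfl : a = 1 - b := by linarith
    simp only [hh, smul_eq_mul, inner_sub_right, inner_add_right, inner_smul_right]
    ring
  have hclosed : IsClosed {x : H | ε ≤ inner ℝ (x - q) v} :=
    isClosed_le continuous_const (by fun_prop)
  have hconvex : Convex ℝ {x : H | ε ≤ inner ℝ (x - q) v} := by
    intro x hx z hz a b ha hb hab
    have h1 := mul_le_mul_of_nonneg_left hx ha
    have h2 := mul_le_mul_of_nonneg_left hz hb
    obtain rfl : a = 1 - b := by linarith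
    simp only [mem_ofPred_eq, inner_sub_left, inner_add_left, real_inner_smul_left] at h1 h2 ⊢
    linarith
  obtain ⟨x, hx⟩ := nonempty_iInter_of_antitone
    (C := fun k : ℕ => {x | x ∈ effDom f ∧ (f x).toReal + h x ≤ 1 / ((k : ℝ) + 1)} ∩
      {x : H | ε ≤ inner ℝ (x - q) v})
    (fun k l hkl x hx => ⟨⟨hx.1.1, hx.1.2.trans (Nat.one_div_le_one_div (α := ℝ) hkl)⟩, hx.2⟩)
    (fun k => by
      have hk : (0 : ℝ) < (k : ℝ) + 2 := by positivity
      -- With `t * K ≤ 1 / (k + 2)`, the bound `g x ≤ t * K * (g x + 1)` yields `g x ≤ 1 / (k + 1)`.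
      obtain ⟨t, ht, x, hx, hlt⟩ := hcon (1 / (K * (k + 2))) (by positivity)
      have htK : t * K * (k + 2) ≤ 1 := by
        have := (lt_div_iff₀ (mul_pos hK0 hk)).1 ht.2
        linarith
      have hgt : g x < t * (inner ℝ (x - q) v - ε) := by
        rw [inner_add_right, inner_smul_right] at hlt
        simp only [hg, inner_sub_left, inner_sub_right]
        rw [real_inner_comm x w, real_inner_comm q w]
        linarith
      refine ⟨x, ⟨hx, ?_⟩, ?_⟩
      · rw [← hgh, le_div_iff₀ (by positivity)]
        have h1 := mul_le_mul_of_nonneg_left (hv x hx) ht.1.le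
        have h2 := mul_pos ht.1 hε
        have h3 : g x ≤ t * K * (g x + 1) := by linarith
        have h4 := mul_le_mul_of_nonneg_right h3 hk.le
        have h5 := mul_le_mul_of_nonneg_right htK (add_nonneg (hg0 x hx) zero_le_one)
        linarith
      · have h1 := (hg0 x hx).trans_lt hgt
        have := pos_of_mul_pos_right h1 ht.1.le
        exact (sub_pos.1 this).le)
    (fun k => (hf.isClosed_sublevel hcont _).inter hclosed)
    (fun k => (hf.convex_sublevel hconv _).inter hconvex)
    (by
      refine (Metric.isBounded_closedBall (x := (0 : H)) (r := (1 + B) / δ)).subset ?_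
      rintro x ⟨⟨hx, hxc⟩, -⟩
      rw [mem_closedBall_zero_iff]
      refine (hgrow x hx).trans (div_le_div_of_nonneg_right ?_ hδ.le)
      rw [← hgh] at hxc
      simpa using hxc)
  rw [mem_iInter] at hx
  have hxd : x ∈ effDom f := (hx 0).1.1
  have hgx : g x ≤ 0 := ge_of_tendsto' (tendsto_one_div_add_atTop_nhds_zero_nat (𝕜 := ℝ))
    fun k => (hgh x).trans_le (hx k).1.2
  have hwx : w ∈ subdiff f x := by
    refine (mem_subdiff_iff hf.ne_bot hxd).2 fun z hz => ?_
    have := hw1 z hz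
    simp only [hg, inner_sub_right] at hgx this ⊢
    linarith
  have hxe := (hx 0).2
  rw [hs.eq_of_mem_subdiff hf hwx hw, mem_ofPred_eq, sub_self, inner_zero_left] at hxe
  exact absurd hε (not_lt.2 hxe)

/-- `f*` is Gâteaux differentiable on the range of `∂f`, with gradient `(∂f)⁻¹`. -/
theorem EssentiallyStrictlyConvex.hasGateauxGradientAt_conjugate [CompleteSpace H] {f : H → EReal}
    (hf : GammaZero f) (hs : EssentiallyStrictlyConvex f) {q w : H} (hw : w ∈ subdiff f q) :
    HasGateauxGradientAt (conjugate f) q w := by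
  have hq := mem_effDom_of_mem_subdiff hf.proper hw
  have hval := hf.toReal_conjugate_eq hw
  have hint : w ∈ intDom (conjugate f) := by
    obtain ⟨δ, hδ, C, hC⟩ := hs.exists_conjugate_bound hf hw
    refine mem_interior_iff_mem_nhds.2 (mem_of_superset (Metric.closedBall_mem_nhds w hδ) ?_)
    intro v hv
    exact ((le_coe_iff hf.conjugate_ne_bot).1 ((conjugate_le_coe_iff hf.ne_bot).2 (hC v hv))).1
  refine ⟨hint, fun v => ?_⟩
  have hdom : ∀ᶠ t : ℝ in 𝓝 0, w + t • v ∈ effDom (conjugate f) := by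
    have hc : ContinuousAt (fun t : ℝ => w + t • v) 0 := by fun_prop
    exact hc (by simpa using mem_interior_iff_mem_nhds.1 hint)
  rw [HasLineDerivAt, hasDerivAt_iff_isLittleO, Asymptotics.isLittleO_iff]
  intro ε hε
  obtain ⟨τ₁, hτ₁, h1⟩ := hs.conjugate_slope_bound hf hw v hε
  obtain ⟨τ₂, hτ₂, h2⟩ := hs.conjugate_slope_bound hf hw (-v) hε
  filter_upwards [hdom, Ioo_mem_nhds (neg_lt_zero.2 hτ₂) hτ₁] with t htd ht
  have hlow := (hf.toReal_conjugate_le_iff htd).1 le_rfl q hq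
  rw [inner_add_right, inner_smul_right] at hlow
  simp only [sub_zero, zero_smul, add_zero, smul_eq_mul]
  rw [hval.2, Real.norm_of_nonneg (by linarith), Real.norm_eq_abs]
  rcases lt_trichotomy t 0 with h0 | rfl | h0
  · have := (hf.toReal_conjugate_le_iff (c := inner ℝ q w - (f q).toReal
      + -t * (inner ℝ q (-v) + ε)) htd).2 (by
        have := h2 (-t) ⟨neg_pos.2 h0, neg_lt.1 ht.1⟩
        rwa [neg_smul_neg] at this)
    rw [abs_of_neg h0]
    rw [inner_neg_right] at this
    linarith
  · simp [hval.2]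
  · have := (hf.toReal_conjugate_le_iff htd).2 (h1 t ⟨h0, ht.2⟩)
    rw [abs_of_pos h0]
    linarith

/-- The converse inclusion `∂f* ⊆ (∂f)⁻¹`, at points where `f` is subdifferentiable; there no
biconjugate theorem is needed. -/
theorem GammaZero.mem_subdiff_of_conjugate {f : H → EReal} (hf : GammaZero f) {q u w : H}
    (hu : u ∈ subdiff f q) (hw : HasGateauxGradientAt (conjugate f) q w) : w ∈ subdiff f q := by
  have hq := mem_effDom_of_mem_subdiff hf.proper hu
  have hwd := intDom_subset _ hw.1
  obtain ⟨hud, huv⟩ := hf.toReal_conjugate_eq hu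
  have h1 := (mem_subdiff_iff hf.conjugate_ne_bot hwd).1
    (hw.mem_subdiff hf.conjugate_ne_bot (convex_epigraph_conjugate hf.ne_bot)) u hud
  refine (mem_subdiff_iff hf.ne_bot hq).2 fun z hz => ?_
  have h2 := (hf.toReal_conjugate_le_iff hwd).1 le_rfl z hz
  rw [huv] at h1
  rw [real_inner_comm, inner_sub_left]
  rw [inner_sub_right] at h1
  linarith

theorem Legendre.hasGateauxGradientAt_conjugate_iff [CompleteSpace H] {f : H → EReal}
    (hf : GammaZero f) (hL : Legendre f) {q w : H} (hq : q ∈ intDom f) :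
    HasGateauxGradientAt (conjugate f) q w ↔ w = gradient f q := by
  have hu := hL.gradient_mem_subdiff hf hq
  constructor
  · intro h
    exact (hL.hasGateauxGradientAt hq).eq_of_mem_subdiff hf.ne_bot
      (hf.mem_subdiff_of_conjugate hu h)
  · rintro rfl
    exact hL.strict.hasGateauxGradientAt_conjugate hf hu

/-! ### Minimizers and the boundary of the domain -/

/-- A boundary point `z` of the domain cannot minimize `f - ⟪w, ·⟫` on a segment from `z` to an
interior point `a`. Otherwise the gradients along the segment would be bounded, pointwise by the
subgradient inequality at the points `a + r • x` and then uniformly by Banach–Steinhaus, against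
their blow-up at `z`. -/
theorem Legendre.mem_intDom_of_isMin [CompleteSpace H] {f : H → EReal} (hf : GammaZero f)
    (hL : Legendre f) {a z w : H} (ha : a ∈ intDom f) (hz : z ∈ effDom f)
    (hmin : ∀ t ∈ Ioc (0 : ℝ) 1,
      (f z).toReal + t * inner ℝ w (a - z) ≤ (f (z + t • (a - z))).toReal) :
    z ∈ intDom f := by
  by_contra hn
  set t : ℕ → ℝ := fun k => 1 / ((k : ℝ) + 1) with ht
  have ht1 : ∀ k, t k ∈ Ioc (0 : ℝ) 1 := fun k =>
    ⟨Nat.one_div_pos_of_nat, by simpa [ht] using Nat.one_div_le_one_div (α := ℝ) (Nat.zero_le k)⟩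
  set x : ℕ → H := fun k => z + t k • (a - z) with hx
  have hxi : ∀ k, x k ∈ intDom f := fun k =>
    hf.convexOn.1.add_smul_sub_mem_interior hz ha (ht1 k)
  have hlim : Tendsto x atTop (𝓝 z) := by
    have : Tendsto x atTop (𝓝 (z + (0 : ℝ) • (a - z))) :=
      ((tendsto_one_div_add_atTop_nhds_zero_nat (𝕜 := ℝ)).smul_const (a - z)).const_add z
    simpa using this
  have hblow := hL.smooth.blowup x z hxi ⟨subset_closure hz, hn⟩ hlim
  set u : ℕ → H := fun k => gradient f (x k) with hu
  have hsub : ∀ k, ∀ b ∈ effDom f, (f (x k)).toReal + inner ℝ (u k) (b - x k) ≤ (f b).toReal :=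
    fun k => (mem_subdiff_iff hf.ne_bot (intDom_subset f (hxi k))).1
      (hL.gradient_mem_subdiff hf (hxi k))
  set c := inner ℝ w (a - z) with hc
  have hdir : ∀ k, c ≤ inner ℝ (u k) (a - z) := fun k => by
    have h1 := hsub k z hz
    have h2 := hmin (t k) (ht1 k)
    have e : z - x k = -(t k • (a - z)) := by simp only [hx]; abel
    rw [e, inner_neg_right, inner_smul_right] at h1
    refine le_of_mul_le_mul_left ?_ (ht1 k).1
    linarith
  have habs : ∀ s ∈ Icc (0 : ℝ) 1, -|c| ≤ s * c := fun s hs => by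
    have h1 : |s * c| ≤ |c| := by
      rw [abs_mul, abs_of_nonneg hs.1]
      exact mul_le_of_le_one_left (abs_nonneg c) hs.2
    linarith [neg_abs_le (s * c)]
  have hub : ∀ k b, a + b ∈ effDom f →
      inner ℝ (u k) b ≤ (f (a + b)).toReal - (f z).toReal + 2 * |c| := fun k b hb => by
    have h1 := hsub k _ hb
    have h2 := hmin (t k) (ht1 k)
    have e : a + b - x k = (1 - t k) • (a - z) + b := by simp only [hx]; module
    rw [e, inner_add_right, inner_smul_right] at h1
    have hs := sub_nonneg.2 (ht1 k).2
    have h3 := mul_le_mul_of_nonneg_left (hdir k) hs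
    have h4 := habs (1 - t k) ⟨hs, by linarith [(ht1 k).1]⟩
    have h5 := habs (t k) ⟨(ht1 k).1.le, (ht1 k).2⟩
    linarith
  obtain ⟨B, hB⟩ := banach_steinhaus (g := fun k => innerSL ℝ (u k)) fun b => by
    have hnhds : ∀ᶠ r : ℝ in 𝓝[>] 0, a + r • b ∈ effDom f ∧ a + r • (-b) ∈ effDom f := by
      refine eventually_nhdsWithin_of_eventually_nhds (Eventually.and ?_ ?_)
      · have h1 : ContinuousAt (fun r : ℝ => a + r • b) 0 := by fun_prop
        exact h1 (by simpa using mem_interior_iff_mem_nhds.1 ha)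
      · have h1 : ContinuousAt (fun r : ℝ => a + r • (-b)) 0 := by fun_prop
        exact h1 (by simpa using mem_interior_iff_mem_nhds.1 ha)
    obtain ⟨r, ⟨hr1, hr2⟩, hr⟩ := (hnhds.and self_mem_nhdsWithin).exists
    refine ⟨max ((f (a + r • b)).toReal - (f z).toReal + 2 * |c|)
      ((f (a + r • (-b))).toReal - (f z).toReal + 2 * |c|) / r, fun k => ?_⟩
    have h1 := hub k _ hr1
    have h2 := hub k _ hr2
    rw [innerSL_apply_apply, Real.norm_eq_abs, le_div_iff₀ hr, ← abs_of_pos hr, ← abs_mul,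
      abs_of_pos hr]
    rw [inner_smul_right] at h1 h2
    rw [inner_neg_right] at h2
    exact abs_le'.2 ⟨le_max_of_le_left (by linarith), le_max_of_le_right (by linarith)⟩
  obtain ⟨k, hk⟩ := (hblow.eventually_gt_atTop B).exists
  have := hB k
  rw [innerSL_apply_norm] at this
  exact absurd hk (not_lt.2 this)

/-! ### Bregman projections and equidistant points -/

theorem distance_eq_coe {f : H → EReal} (hbot : ∀ x, f x ≠ ⊥) {x y : H} (hx : x ∈ effDom f)
    (hy : y ∈ intDom f) : distance f x y =
      (((f x).toReal - (f y).toReal - inner ℝ (gradient f y) (x - y) : ℝ) : EReal) := by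
  rw [distance, if_pos hy, ← coe_toReal hbot hx, ← coe_toReal hbot (intDom_subset f hy),
    EReal.toReal_coe, EReal.toReal_coe, ← EReal.coe_sub, ← EReal.coe_sub]

theorem distance_le_distance_iff {f : H → EReal} (hbot : ∀ x, f x ≠ ⊥) {x x' y : H}
    (hx : x ∈ effDom f) (hy : y ∈ intDom f) : distance f x y ≤ distance f x' y ↔
      (x' ∈ effDom f → (f x).toReal + inner ℝ (gradient f y) (x' - x) ≤ (f x').toReal) := by
  by_cases hx' : x' ∈ effDom f
  · rw [distance_eq_coe hbot hx hy, distance_eq_coe hbot hx' hy, EReal.coe_le_coe_iff]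
    simp only [hx', forall_true_left, inner_sub_right]
    constructor <;> intro h <;> linarith
  · have h1 : f x' = ⊤ := by simpa [effDom] using hx'
    have h2 : distance f x' y = ⊤ := by
      rw [distance, if_pos hy, h1, ← coe_toReal hbot (intDom_subset f hy), EReal.top_sub_coe,
        EReal.top_sub_coe]
    simp [h2, hx']

theorem distance_eq_distance_iff {f : H → EReal} (hbot : ∀ x, f x ≠ ⊥) {x x' y : H}
    (hx : x ∈ effDom f) (hx' : x' ∈ effDom f) (hy : y ∈ intDom f) :
    distance f x y = distance f x' y ↔
      inner ℝ (gradient f y) (x - x') = (f x).toReal - (f x').toReal := by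
  rw [distance_eq_coe hbot hx hy, distance_eq_coe hbot hx' hy, EReal.coe_eq_coe_iff]
  simp only [inner_sub_right]
  constructor <;> intro h <;> linarith

/-- The point `q` is equidistant iff `⟪∇f q, p i - p 0⟫ = f (p i) - f (p 0)` for all `i`, so two
equidistant points have gradients that differ by a vector of `Mᗮ`. -/
theorem mem_forwardEquidistant_iff {f : H → EReal} (hbot : ∀ x, f x ≠ ⊥) {m : ℕ}
    {p : Fin (m + 1) → H} (hp : ∀ i, p i ∈ effDom f) {y : H}
    (hy : y ∈ forwardEquidistant f (range p)) {q : H} :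
    q ∈ forwardEquidistant f (range p) ↔ q ∈ intDom f ∧
      gradient f q - gradient f y ∈ (Submodule.span ℝ (range fun i : Fin m => p i.succ - p 0))ᗮ := by
  have hyd : ∀ i, inner ℝ (gradient f y) (p i - p 0) = (f (p i)).toReal - (f (p 0)).toReal :=
    fun i => (distance_eq_distance_iff hbot (hp i) (hp 0) hy.1).1
      (hy.2 _ (mem_range_self i) _ (mem_range_self 0))
  refine and_congr_right fun hq => ?_
  rw [Submodule.mem_orthogonal]
  constructor
  · intro h v hv
    induction hv using Submodule.span_induction with
    | mem v hv =>
      obtain ⟨i, rfl⟩ := hv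
      have h1 := (distance_eq_distance_iff hbot (hp i.succ) (hp 0) hq).1
        (h _ (mem_range_self _) _ (mem_range_self 0))
      rw [real_inner_comm, inner_sub_left, hyd, h1, sub_self]
    | zero => exact inner_zero_left _
    | add a b _ _ ha hb => rw [inner_add_left, ha, hb, add_zero]
    | smul c a _ ha => rw [real_inner_smul_left, ha, mul_zero]
  · intro h
    have h0 : ∀ i, distance f (p i) q = distance f (p 0) q := by
      intro i
      rw [distance_eq_distance_iff hbot (hp i) (hp 0) hq, ← hyd i]
      refine Fin.cases (by simp) (fun j => ?_) i
      have := h _ (Submodule.subset_span (mem_range_self j))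
      rw [real_inner_comm, inner_sub_left] at this
      linarith
    rintro _ ⟨i, rfl⟩ _ ⟨j, rfl⟩
    rw [h0 i, h0 j]

/-- A closed convex set that meets `int dom f` has exactly one backward Bregman projection of each
interior point, and this projection is again interior. -/
theorem Legendre.exists_backwardProj_eq [CompleteSpace H] {f : H → EReal} (hf : GammaZero f)
    (hL : Legendre f) {A : Set H} (hcl : IsClosed A) (hconv : Convex ℝ A)
    (hA : (A ∩ intDom f).Nonempty) {y : H} (hy : y ∈ intDom f) :
    ∃ z ∈ intDom f, backwardProj f A y = {z} := by
  obtain ⟨a, haA, ha⟩ := hA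
  set w := gradient f y with hw
  have hsub := hL.gradient_mem_subdiff hf hy
  have hsub1 := (mem_subdiff_iff hf.ne_bot (intDom_subset f hy)).1 hsub
  obtain ⟨δ, hδ, C, hC⟩ := hL.strict.exists_linear_growth hf hsub
  have hlin : ConvexOn ℝ univ fun x : H => -inner ℝ w x := by
    refine ⟨convex_univ, fun x _ z _ a b ha hb hab => le_of_eq ?_⟩
    simp only [smul_eq_mul, inner_add_right, inner_smul_right]
    ring
  have hset : ∀ c, {x | x ∈ A ∩ effDom f ∧ (f x).toReal + -inner ℝ w x ≤ c}
      = A ∩ {x | x ∈ effDom f ∧ (f x).toReal + -inner ℝ w x ≤ c} := fun c => by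
    ext x; exact and_assoc
  obtain ⟨z, hz, hmin⟩ := exists_isMinOn_of_sublevel (D := A ∩ effDom f)
    (φ := fun x => (f x).toReal + -inner ℝ w x) ⟨a, haA, intDom_subset f ha⟩
    (by
      refine ⟨(f y).toReal - inner ℝ w y, ?_⟩
      rintro _ ⟨x, hx, rfl⟩
      have := hsub1 x hx.2
      rw [inner_sub_right] at this
      simp only
      linarith)
    (fun c => by
      rw [hset]
      exact hcl.inter (hf.isClosed_sublevel (by fun_prop) c))
    (fun c => by
      rw [hset]
      exact hconv.inter (hf.convex_sublevel hlin c))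
    (fun c => by
      refine (Metric.isBounded_closedBall (x := (0 : H)) (r := (c + C) / δ)).subset ?_
      rintro x ⟨hx, hxc⟩
      rw [mem_closedBall_zero_iff, le_div_iff₀ hδ]
      have := hC x hx.2
      linarith)
  have hproj : ∀ u, u ∈ backwardProj f A y ↔ u ∈ A ∩ effDom f ∧
      ∀ x ∈ A ∩ effDom f, (f u).toReal + inner ℝ w (x - u) ≤ (f x).toReal := by
    intro u
    refine and_congr_right fun hu => ?_
    constructor
    · exact fun h x hx => (distance_le_distance_iff hf.ne_bot hu.2 hy).1 (h x hx.1) hx.2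
    · exact fun h x hx => (distance_le_distance_iff hf.ne_bot hu.2 hy).2 fun hxd => h x ⟨hx, hxd⟩
  have hzp : z ∈ backwardProj f A y := (hproj z).2 ⟨hz, fun x hx => by
    have := hmin x hx
    rw [inner_sub_right]
    linarith⟩
  have hint : ∀ u ∈ backwardProj f A y, u ∈ intDom f := by
    intro u hu
    obtain ⟨huA, humin⟩ := (hproj u).1 hu
    refine hL.mem_intDom_of_isMin hf (w := w) ha huA.2 fun t ht => ?_
    have hmem := (hconv.inter hf.convexOn.1).add_smul_sub_mem huA
      ⟨haA, intDom_subset f ha⟩ (Ioc_subset_Icc_self ht)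
    have := humin _ hmem
    rwa [add_sub_cancel_left, inner_smul_right] at this
  refine ⟨z, hint z hzp, eq_singleton_iff_unique_mem.2 ⟨hzp, fun u hu => ?_⟩⟩
  -- Two minimizers would lie in `int dom f = dom ∂f`, where `f` is strictly convex.
  by_contra hne
  have hui := hint u hu
  have hzi := hint z hzp
  obtain ⟨huA, humin⟩ := (hproj u).1 hu
  have hzmin := ((hproj z).1 hzp).2
  have hst := (hL.strict.strictConvex (intDom f) hL.smooth.subdiffDom_eq.ge
    hf.convexOn.1.interior).2 hui hzi hne one_half_pos one_half_pos (add_halves 1)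
  have h1 := humin _ ((hconv.inter hf.convexOn.1) huA hz one_half_pos.le one_half_pos.le
    (add_halves 1))
  have h2 := hzmin u huA
  simp only [smul_eq_mul, inner_sub_right, inner_add_right, inner_smul_right] at hst h1 h2
  linarith

/-- First-order condition for a projection onto an affine subspace. -/
theorem Legendre.inner_gradient_sub_eq_zero {f : H → EReal} (hf : GammaZero f) (hL : Legendre f)
    {A : AffineSubspace ℝ H} {y z : H} (hy : y ∈ intDom f) (hz : z ∈ intDom f)
    (hproj : z ∈ backwardProj f (A : Set H) y) {v : H} (hv : v ∈ A.direction) :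
    inner ℝ (gradient f z - gradient f y) v = 0 := by
  have hd : HasDerivAt (fun t : ℝ => (f (z + t • v)).toReal - t * inner ℝ (gradient f y) v)
      (inner ℝ (gradient f z) v - 1 * inner ℝ (gradient f y) v) 0 :=
    HasDerivAt.sub ((hL.hasGateauxGradientAt hz).2 v) ((hasDerivAt_id (0 : ℝ)).mul_const _)
  have hmin : IsLocalMin
      (fun t : ℝ => (f (z + t • v)).toReal - t * inner ℝ (gradient f y) v) 0 := by
    have hc : ContinuousAt (fun t : ℝ => z + t • v) 0 := by fun_prop
    have hn : effDom f ∈ 𝓝 (z + (0 : ℝ) • v) := by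
      simpa using mem_interior_iff_mem_nhds.1 hz
    filter_upwards [hc hn] with t ht
    have hmem : z + t • v ∈ A := by
      rw [add_comm]
      exact AffineSubspace.vadd_mem_of_mem_direction (A.direction.smul_mem t hv) hproj.1.1
    have := (distance_le_distance_iff hf.ne_bot hproj.1.2 hy).1 (hproj.2 _ hmem) ht
    rw [add_sub_cancel_left, inner_smul_right] at this
    simp only [zero_smul, add_zero, zero_mul, sub_zero]
    linarith
  have := hmin.hasDerivAt_eq_zero hd
  rw [inner_sub_left]
  linarith

end Bregman

theorem theorem4p5 {H : Type*} [NormedAddCommGroup H] [InnerProductSpace ℝ H] [CompleteSpace H]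
    (f : H → EReal) (hf : Bregman.GammaZero f) (hL : Bregman.Legendre f)
    (m : ℕ) (p : Fin (m + 1) → H) (hp : ∀ i, p i ∈ Bregman.effDom f)
    (y : H) (hy : y ∈ Bregman.forwardEquidistant f (Set.range p)) :
    (Bregman.forwardCircumcenters f (Set.range p) =
      (affineSpan ℝ (Set.range p) : Set H) ∩ Bregman.intDom f ∩
        Bregman.gradientImage (Bregman.conjugate f)
          ((fun v => Bregman.gradient f y + v) ''
            ((Submodule.span ℝ (Set.range fun i : Fin m => p i.succ - p 0))ᗮ : Set H))) ∧
    (((affineSpan ℝ (Set.range p) : Set H) ∩ Bregman.intDom f).Nonempty →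
      ∃ z, Bregman.backwardProj f (affineSpan ℝ (Set.range p) : Set H) y = {z} ∧
        z ∈ Bregman.forwardCircumcenters f (Set.range p)) ∧
    ((Bregman.effDom f = Set.univ ∨ (Set.range p ∩ Bregman.intDom f).Nonempty) →
      ((affineSpan ℝ (Set.range p) : Set H) ∩ Bregman.intDom f).Nonempty) := by
  have hmemA : ∀ i, p i ∈ affineSpan ℝ (Set.range p) := fun i =>
    mem_affineSpan ℝ (Set.mem_range_self i)
  have hequi := fun q => Bregman.mem_forwardEquidistant_iff hf.ne_bot hp hy (q := q)
  refine ⟨?_, fun hA => ?_, ?_⟩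
  · ext q
    constructor
    · rintro ⟨hqA, hqE⟩
      obtain ⟨hq, horth⟩ := (hequi q).1 hqE
      exact ⟨⟨hqA, hq⟩, Bregman.gradient f q, ⟨_, horth, add_sub_cancel _ _⟩,
        (hL.hasGateauxGradientAt_conjugate_iff hf hq).2 rfl⟩
    · rintro ⟨⟨hqA, hq⟩, _, ⟨v, hv, rfl⟩, hg⟩
      refine ⟨hqA, (hequi q).2 ⟨hq, ?_⟩⟩
      rw [← (hL.hasGateauxGradientAt_conjugate_iff hf hq).1 hg, add_sub_cancel_left]
      exact hv
  · obtain ⟨z, hz, hproj⟩ := hL.exists_backwardProj_eq hf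
      (affineSpan ℝ (Set.range p)).closed_of_finiteDimensional
      (affineSpan ℝ (Set.range p)).convex hA hy.1
    have hzp : z ∈ Bregman.backwardProj f (affineSpan ℝ (Set.range p) : Set H) y :=
      hproj ▸ Set.mem_singleton z
    refine ⟨z, hproj, hzp.1.1, (hequi z).2 ⟨hz, ?_⟩⟩
    have hspan : Submodule.span ℝ (Set.range fun i : Fin m => p i.succ - p 0) ≤
        (affineSpan ℝ (Set.range p)).direction := by
      rw [Submodule.span_le]
      rintro _ ⟨i, rfl⟩
      exact AffineSubspace.vsub_mem_direction (hmemA _) (hmemA _)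
    rw [Submodule.mem_orthogonal']
    exact fun v hv => hL.inner_gradient_sub_eq_zero hf hy.1 hz hzp (hspan hv)
  · rintro (hdom | ⟨x, ⟨i, rfl⟩, hx⟩)
    · exact ⟨p 0, hmemA 0, by simp [Bregman.intDom, hdom]⟩
    · exact ⟨p i, hmemA i, hx⟩
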